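/- Let $\Bbbk$ be an algebraically closed field, $G$ a linear algebraic group over $\Bbbk$, and $H=\Bbbk[G]$ its coordinate Hopf algebra (a finitely generated reduced commutative Hopf algebra whose $\Bbbk$-points form $G$), with coproduct $\Delta(h)=h_{(1)}\otimes h_{(2)}$ and antipode $S$. For $g\in G$ let $L_g h=h_{(1)}(g)h_{(2)}$, i.e. $(L_gh)(x)=h(gx)$. Let $M_n=H^n$ be the free $H$-module of rank $n$. Let $\mathrm{Cend}_n=\mathrm{Cend}^{G,G}_n$ be the space of all maps $a:G\to \mathrm{End}_{\Bbbk} M_n$ such that $g\mapsto a(g)u$ is a regular $M_n$-valued function on $G$ for each $u\in M_n$, and $a(g)(fu)=(L_gf)\,a(g)u$ for all $g\in G$, $f\in H$, $u\in M_n$. It is an $H$-module by $(fa)(g)=f(g^{-1})a(g)$ and carries the operations $(a\circ_g b)(z)=a(g)\,b(zg^{-1})$, $g\in G$. A conformal subalgebra of $\mathrm{Cend}_n$ is an $H$-submodule closed under all operations $\circ_g$; a left ideal is an $H$-submodule $B$ with $a\circ_g b\in B$ for all $a\in \mathrm{Cend}_n$, $b\in B$, $g\in G$. The space $H\otimes H\otimes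 \mathbb M_n(\Bbbk)\simeq H\otimes\mathbb M_n(H)$ is identified with $\mathrm{Cend}_n$ by letting $h\otimes f\otimes A$ be the map $g\mapsto h(g^{-1})\,fL_g\otimes A$. Let $\mathcal F$ be the linear transformation of this space given by $\mathcal F(f\otimes a\otimes A)=fS(a_{(1)})\otimes a_{(2)}\otimes A$. A conformal subalgebra $C$ is irreducible if the only $H$-submodules of $M_n$ invariant under all operators $a(g)$, $a\in C$, $g\in G$, are $\{0\}$ and $M_n$. A left ideal of a ring is essential if it has nonzero intersection with every nonzero left ideal. **Theorem.** Let $C\neq 0$ be an irreducible conformal subalgebra of $\mathrm{Cend}_n$. Let $C_1=(1\otimes H\otimes E)C$, i.e. the linear span of all maps $g\mapsto h\,c(g)$ with $h\in H$, $c\in C$. Then $C_1$ is a left ideal of $\mathrm{Cend}_n$, and $C_1=\mathcal F(H\otimes B_0)$ for some essential left ideal $B_0$ of $\mathbb M_n(H)$. In particular, if $G=\{e\}$ (so that $\mathrm{Cend}_n=\mathbb M_n(\Bbbk)$), then $C=\mathrm{Cend}_n$, which is Burnside's theorem. -/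

import Mathlib

open scoped TensorProduct

noncomputable section

namespace GConf

section

variable (k H : Type*) [Field k] [CommRing H] [HopfAlgebra k H]

/-- The group `G` of `k`-points of the commutative Hopf algebra `H`. Over an algebraically closed
field, when `H` is finitely generated and reduced, this is the linear algebraic group with
coordinate algebra `H`, and `h ∈ H` is the regular function `g ↦ g h` on it. The group law is the
convolution product: `(g₁ * g₂) h = ∑ g₁ h₍₁₎ * g₂ h₍₂₎`, `1 = ε`, `g⁻¹ = g ∘ S`. -/
abbrev Pt : Type _ := WithConv (H →ₐ[k] k)

end

variable {k H : Type*} [Field k] [CommRing H] [HopfAlgebra k H]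

/-- The value at the point `g` of an `M`-valued regular function on `G`, that is, of an element
of `H ⊗ M`: `h ⊗ v ↦ h(g) v`. -/
def evalAt {M : Type*} [AddCommGroup M] [Module k M] (g : Pt k H) : H ⊗[k] M →ₗ[k] M :=
  (TensorProduct.lid k M).toLinearMap ∘ₗ LinearMap.rTensor M g.ofConv.toLinearMap

/-- A map `a : G → End M` is locally regular if `g ↦ a(g) u` is a regular `M`-valued function
for every `u ∈ M`. -/
def LocallyRegular {M : Type*} [AddCommGroup M] [Module k M]
    (a : Pt k H → Module.End k M) : Prop :=
  ∀ u : M, ∃ t : H ⊗[k] M, ∀ g : Pt k H, a g u = evalAt g t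

/-- The left shift `L_g h = h₍₁₎(g) h₍₂₎`, i.e. `(L_g h)(x) = h(g x)`. -/
def leftShift (g : Pt k H) : H →ₗ[k] H :=
  evalAt g ∘ₗ Coalgebra.comul

variable {n : ℕ}

variable (k H n) in
/-- Maps from `G` to the `k`-linear endomorphisms of the free `H`-module `M_n = H^n`. -/
abbrev EndMap : Type _ := Pt k H → Module.End k (Fin n → H)

variable (k H n) in
/-- `Cend_n`: the space of conformal endomorphisms of `M_n = H^n`, i.e. of the locally regular maps
`a : G → End M_n` that are translation invariant, `a(g)(f u) = (L_g f) (a(g) u)`. -/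
def Cend : Submodule k (EndMap k H n) where
  carrier := {a | LocallyRegular a ∧
    ∀ (g : Pt k H) (f : H) (u : Fin n → H), a g (f • u) = leftShift g f • a g u}
  add_mem' := by
    rintro a b ⟨ha, ha'⟩ ⟨hb, hb'⟩
    refine ⟨fun u => ?_, fun g f u => ?_⟩
    · obtain ⟨s, hs⟩ := ha u
      obtain ⟨t, ht⟩ := hb u
      exact ⟨s + t, fun g => by simp [hs, ht]⟩
    · simp [ha', hb']
  zero_mem' := ⟨fun _ => ⟨0, fun g => by simp⟩, fun g f u => by simp⟩
  smul_mem' := by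
    rintro c a ⟨ha, ha'⟩
    refine ⟨fun u => ?_, fun g f u => ?_⟩
    · obtain ⟨s, hs⟩ := ha u
      exact ⟨c • s, fun g => by simp [hs]⟩
    · simp only [Pi.smul_apply, LinearMap.smul_apply, ha']
      exact smul_comm _ _ _

/-- The `H`-module structure of `Cend_n`: `(f a)(g) = f(g⁻¹) a(g)`. -/
def hAct (f : H) (a : EndMap k H n) : EndMap k H n :=
  fun g => g⁻¹ f • a g

/-- The conformal products: `(a ∘_g b)(z) = a(g) b(z g⁻¹)`. -/
def cProd (g : Pt k H) (a b : EndMap k H n) : EndMap k H n :=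
  fun z => a g * b (z * g⁻¹)

/-- Conformal subalgebras of `Cend_n`: the `H`-submodules closed under all products `∘_g`. -/
structure IsConformalSubalgebra (C : Submodule k (EndMap k H n)) : Prop where
  le_cend : C ≤ Cend k H n
  hAct_mem : ∀ (f : H), ∀ a ∈ C, hAct f a ∈ C
  cProd_mem : ∀ (g : Pt k H), ∀ a ∈ C, ∀ b ∈ C, cProd g a b ∈ C

/-- Left ideals of the conformal algebra `Cend_n`. -/
structure IsLeftIdeal (B : Submodule k (EndMap k H n)) : Prop where
  le_cend : B ≤ Cend k H n
  hAct_mem : ∀ (f : H), ∀ b ∈ B, hAct f b ∈ B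
  cProd_mem : ∀ (g : Pt k H), ∀ a ∈ Cend k H n, ∀ b ∈ B, cProd g a b ∈ B

/-- `W_n(C)`: the linear span of all operators `a(g)`, `a ∈ C`, `g ∈ G`. -/
def operators (C : Submodule k (EndMap k H n)) : Submodule k (Module.End k (Fin n → H)) :=
  Submodule.span k {α | ∃ a ∈ C, ∃ g : Pt k H, α = a g}

/-- `M_n` has no `W_n(C)`-invariant `H`-submodules except `0` and `M_n`. -/
def IsIrreducible (C : Submodule k (EndMap k H n)) : Prop :=
  ∀ N : Submodule H (Fin n → H),
    (∀ α ∈ operators C, ∀ u ∈ N, α u ∈ N) → N = ⊥ ∨ N = ⊤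

/-- The operator which the element `T` of `H ⊗ H ⊗ M_n(k) = M_n(H ⊗ H)` defines at `g ∈ G`:
`h ⊗ f ⊗ A` goes to `h(g⁻¹) f L_g ⊗ A`. -/
def operatorAt (g : Pt k H) : Matrix (Fin n) (Fin n) (H ⊗[k] H) →ₗ[k]
    Module.End k (Fin n → H) where
  toFun T :=
    { toFun := fun u i => ∑ j, evalAt g⁻¹ (T i j) * leftShift g (u j)
      map_add' := fun u v => by
        ext i
        simp [mul_add, Finset.sum_add_distrib]
      map_smul' := fun c u => by
        ext i
        simp [Finset.smul_sum] }
  map_add' S T := by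
    ext u i
    simp [add_mul, Finset.sum_add_distrib]
  map_smul' c T := by
    ext u i
    simp only [Matrix.smul_apply, map_smul, smul_mul_assoc, LinearMap.comp_apply, LinearMap.coe_mk,
      AddHom.coe_mk, RingHom.id_apply, LinearMap.smul_apply, Pi.smul_apply, Finset.smul_sum]

/-- The identification of `H ⊗ H ⊗ M_n(k) = M_n(H ⊗ H)` with `Cend_n`. -/
def ofTensor : Matrix (Fin n) (Fin n) (H ⊗[k] H) →ₗ[k] EndMap k H n :=
  LinearMap.pi operatorAt

/-- The set of products `(1 ⊗ h ⊗ E) c`, `h ∈ H`, `c ∈ C`, spans `C_1 = (1 ⊗ H ⊗ E) C`. Here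
`(1 ⊗ h ⊗ E) c` is the map `g ↦ h c(g)`; see `ofTensor_scalar_mul`. -/
def adjoinH (C : Submodule k (EndMap k H n)) : Submodule k (EndMap k H n) :=
  Submodule.span k {x | ∃ h : H, ∃ c ∈ C, x = fun g => Algebra.lsmul k k (Fin n → H) h * c g}

theorem ofTensor_scalar_mul (h : H) (T : Matrix (Fin n) (Fin n) (H ⊗[k] H)) :
    ofTensor (Matrix.scalar (Fin n) (1 ⊗ₜ[k] h) * T) =
      fun g => Algebra.lsmul k k (Fin n → H) h * ofTensor T g := by
  have key : ∀ (g : Pt k H) (t : H ⊗[k] H), evalAt g ((1 ⊗ₜ[k] h) * t) = h * evalAt g t := by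
    intro g t
    induction t with
    | zero => simp
    | add x y hx hy => simp [mul_add, hx, hy]
    | tmul x y => simp [evalAt]
  funext g
  ext u i
  simp [ofTensor, operatorAt, Matrix.scalar_apply, Matrix.diagonal_mul, key, Finset.mul_sum,
    mul_assoc]

/-- The `H`-linear map `F : H ⊗ H → H ⊗ H`, `F(f ⊗ a) = f S(a₍₁₎) ⊗ a₍₂₎`. -/
def fourier : H ⊗[k] H →ₐ[k] H ⊗[k] H :=
  Algebra.TensorProduct.lift Algebra.TensorProduct.includeLeft
    ((Algebra.TensorProduct.map (HopfAlgebra.antipodeAlgHom k H) (AlgHom.id k H)).comp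
      (Bialgebra.comulAlgHom k H))
    (fun _ _ => Commute.all _ _)

/-- The subspace `H ⊗ B₀` of `H ⊗ M_n(H) = M_n(H ⊗ H)`. -/
def tensorIdeal (B₀ : Ideal (Matrix (Fin n) (Fin n) H)) :
    Submodule k (Matrix (Fin n) (Fin n) (H ⊗[k] H)) :=
  Submodule.span k {T | ∃ h : H, ∃ b ∈ B₀, T = b.map fun x => h ⊗ₜ[k] x}

/-- The subspace `F(H ⊗ B₀)` of `Cend_n`, where `F` is applied entrywise. -/
def fourierIdeal (B₀ : Ideal (Matrix (Fin n) (Fin n) H)) : Submodule k (EndMap k H n) :=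
  ((tensorIdeal (k := k) B₀).map (fourier (k := k) (H := H)).toLinearMap.mapMatrix).map ofTensor

/-- A left ideal is essential if it meets every nonzero left ideal nontrivially. -/
def IsEssential {R : Type*} [Ring R] (B : Ideal R) : Prop :=
  ∀ I : Ideal R, I ≠ ⊥ → B ⊓ I ≠ ⊥

end GConf

end

open scoped TensorProduct

noncomputable section

namespace GConf

/-! A pair of vectors u, v of M_n gives the conformal endomorphism z ↦ (p ↦ L_z(v·p) u), and these
span `Cend` (`exists_kernelMap_eq`). In this parametrization by M_n ⊗ M_n, the product a ∘_g acts as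
a(g) ⊗ 1 (`cProd_kernelMap`), and left multiplication by h acts as h ⊗ 1. Hence the operators α for
which α ⊗ 1 preserves C_1 form an algebra containing H and all a(g), a ∈ C. This algebra acts
irreducibly, and its commutant is k: a commuting map is a matrix over H, subtracting an eigenvalue
of its value at the identity of G makes it non-invertible, and Schur's lemma makes it zero. By
Jacobson density, C_1 is stable under all of End_k(M_n) ⊗ 1 (`stabilizer_adjoinH_eq_top`). It is
therefore a left ideal of the form M_n ⊗ V. Closure under the H-action makes V an H-submodule, and
F(H ⊗ B₀) is the same space, with B₀ the matrices whose rows lie in V (`eq_fourierIdeal_rowIdeal`).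

For essentiality, a vector orthogonal to V is killed by C, hence is zero by irreducibility. Over a
reduced Noetherian ring this forces V to meet every nonzero cyclic submodule
(`exists_smul_mem_of_orthogonal_eq_zero`), by passing to the residue fields of minimal primes. -/

/-! ### Essential submodules of R^n over a reduced Noetherian ring -/

theorem eq_zero_of_mem_radical_bot {R : Type*} [CommRing R] [IsReduced R] {x : R}
    (hx : x ∈ (⊥ : Ideal R).radical) : x = 0 := by
  obtain ⟨m, hm⟩ := hx
  exact IsNilpotent.eq_zero ⟨m, Ideal.mem_bot.mp hm⟩

/-- In a reduced Noetherian ring every minimal prime is annihilated by an element outside of it. -/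
theorem exists_notMem_forall_mul_eq_zero {R : Type*} [CommRing R] [IsNoetherianRing R] [IsReduced R]
    {P : Ideal R} (hP : P ∈ minimalPrimes R) : ∃ t ∉ P, ∀ x ∈ P, t * x = 0 := by
  classical
  have hfin := minimalPrimes.finite_of_isNoetherianRing R
  have hprime : P.IsPrime := hP.1.1
  -- Take t in all the other minimal primes but not in P: then tP lies in every minimal prime, hence
  -- in the nilradical.
  have hnot : ¬ (hfin.toFinset.erase P).inf id ≤ P := by
    rw [hprime.inf_le']
    rintro ⟨Q, hQ, hle⟩
    simp only [Finset.mem_erase, Set.Finite.mem_toFinset] at hQ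
    exact hQ.1 (le_antisymm hle (hP.2 hQ.2.1 hle))
  obtain ⟨t, ht, htP⟩ := SetLike.not_le_iff_exists.mp hnot
  refine ⟨t, htP, fun x hx => ?_⟩
  have hmem : t * x ∈ sInf (minimalPrimes R) := by
    refine Submodule.mem_sInf.mpr fun (Q : Ideal R) hQ => ?_
    by_cases hQP : Q = P
    · exact hQP ▸ P.mul_mem_left t hx
    · have hle : (hfin.toFinset.erase P).inf id ≤ Q :=
        Finset.inf_le (f := id) (by simpa [hQP] using hQ)
      exact Q.mul_mem_right x (hle ht)
  rw [minimalPrimes, Ideal.sInf_minimalPrimes] at hmem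
  exact eq_zero_of_mem_radical_bot hmem

/-- A submodule of `R^n` with no nonzero orthogonal vectors is essential if `R` is reduced and
Noetherian. -/
theorem exists_smul_mem_of_orthogonal_eq_zero {R : Type*} [CommRing R] [IsNoetherianRing R]
    [IsReduced R] {n : ℕ} (V : Submodule R (Fin n → R))
    (hV : ∀ p : Fin n → R, (∀ v ∈ V, v ⬝ᵥ p = 0) → p = 0) {v : Fin n → R} (hv : v ≠ 0) :
    ∃ r : R, r • v ∈ V ∧ r • v ≠ 0 := by
  obtain ⟨i, hi⟩ := Function.ne_iff.mp hv
  obtain ⟨P, hP, hviP⟩ : ∃ P ∈ minimalPrimes R, v i ∉ P := by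
    by_contra! hcon
    refine hi ?_
    have : v i ∈ sInf (minimalPrimes R) := Submodule.mem_sInf.mpr hcon
    rw [minimalPrimes, Ideal.sInf_minimalPrimes] at this
    exact eq_zero_of_mem_radical_bot this
  have hprime : P.IsPrime := hP.1.1
  obtain ⟨t, htP, ht⟩ := exists_notMem_forall_mul_eq_zero hP
  let K := FractionRing (R ⧸ P)
  let ι : R →+* K := (algebraMap (R ⧸ P) K).comp (Ideal.Quotient.mk P)
  have hι : ∀ x, ι x = 0 ↔ x ∈ P := fun x => by
    simp [ι, Ideal.Quotient.eq_zero_iff_mem]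
  -- Either V spans K^n, and clearing denominators moves a multiple of v into V, or a functional
  -- vanishing on V yields a forbidden orthogonal vector.
  let W : Submodule K (Fin n → K) := Submodule.span K ((fun w : Fin n → R => ι ∘ w) '' V)
  by_cases hW : W = ⊤
  · have key : ∀ w ∈ W, ∃ s ∉ P, ∃ v' ∈ V, ι s • w = ι ∘ v' := by
      intro w hw
      induction hw using Submodule.span_induction with
      | mem w hw =>
        obtain ⟨v', hv', rfl⟩ := hw
        exact ⟨1, hprime.one_notMem, v', hv', by simp⟩
      | zero => exact ⟨1, hprime.one_notMem, 0, V.zero_mem, by ext; simp⟩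
      | add x y _ _ hx hy =>
        obtain ⟨s, hs, a, ha, h⟩ := hx
        obtain ⟨s', hs', a', ha', h'⟩ := hy
        refine ⟨s * s', hprime.mul_notMem hs hs', s' • a + s • a',
          V.add_mem (V.smul_mem _ ha) (V.smul_mem _ ha'), ?_⟩
        ext j
        have hj := congrFun h j
        have hj' := congrFun h' j
        simp only [Pi.smul_apply, smul_eq_mul, Function.comp_apply] at hj hj'
        simp only [map_mul, Pi.smul_apply, Pi.add_apply, smul_eq_mul, Function.comp_apply, map_add,
          ← hj, ← hj']
        ring
      | smul c x _ hx =>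
        obtain ⟨s, hs, a, ha, h⟩ := hx
        obtain ⟨y, z, hz, rfl⟩ := IsFractionRing.div_surjective (A := R ⧸ P) c
        obtain ⟨y, rfl⟩ := Ideal.Quotient.mk_surjective y
        obtain ⟨z, rfl⟩ := Ideal.Quotient.mk_surjective z
        have hzP : z ∉ P := fun hzP => nonZeroDivisors.ne_zero hz
          (Ideal.Quotient.eq_zero_iff_mem.mpr hzP)
        have hz0 : ι z ≠ 0 := fun h0 => hzP ((hι z).mp h0)
        refine ⟨s * z, hprime.mul_notMem hs hzP, y • a, V.smul_mem _ ha, ?_⟩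
        ext j
        have hj := congrFun h j
        simp only [Pi.smul_apply, smul_eq_mul, Function.comp_apply] at hj
        simp only [map_mul, Pi.smul_apply, smul_eq_mul, Function.comp_apply, ← hj]
        change ι s * ι z * (ι y / ι z * x j) = ι y * (ι s * x j)
        rw [mul_assoc, ← mul_assoc (ι z), mul_div_cancel₀ _ hz0]
        ring
    obtain ⟨s, hs, v', hv', h⟩ := key (ι ∘ v) (hW ▸ Submodule.mem_top)
    -- The entries of s v - v' lie in P, so t kills them and t s v = t v' ∈ V.
    refine ⟨t * s, ?_, fun h0 => ?_⟩
    · have : (t * s) • v = t • v' := by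
        ext j
        have hj := congrFun h j
        simp only [Pi.smul_apply, smul_eq_mul, Function.comp_apply, ← map_mul] at hj
        have := ht (s * v j - v' j) ((hι _).mp (by rw [map_sub, hj, sub_self]))
        simp only [Pi.smul_apply, smul_eq_mul]
        linear_combination this
      exact this ▸ V.smul_mem t hv'
    · have hmem : t * s * v i ∈ P := by
        have := congrFun h0 i
        simp only [Pi.smul_apply, smul_eq_mul, Pi.zero_apply] at this
        exact this ▸ P.zero_mem
      exact hprime.mul_notMem (hprime.mul_notMem htP hs) hviP hmem
  · exfalso
    obtain ⟨φ, hφ, hle⟩ := W.exists_le_ker_of_lt_top (lt_top_iff_ne_top.mpr hW)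
    obtain ⟨d, hd⟩ := IsLocalization.exist_integer_multiples_of_finite
      (nonZeroDivisors (R ⧸ P)) (fun j => φ (Pi.single j 1))
    choose p' hp' using hd
    choose p hp using fun j => Ideal.Quotient.mk_surjective (p' j)
    have hd0 : algebraMap (R ⧸ P) K d ≠ 0 := by
      simp
    have hpι : ∀ j, ι (p j) = algebraMap (R ⧸ P) K d * φ (Pi.single j 1) := fun j => by
      rw [← Algebra.smul_def, ← hp' j, ← hp j]
      rfl
    have hφ' : ∀ w : Fin n → K, φ w = ∑ j, w j * φ (Pi.single j 1) := fun w => by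
      conv_lhs => rw [← Finset.univ_sum_single w]
      rw [map_sum]
      refine Finset.sum_congr rfl fun j _ => ?_
      rw [← smul_eq_mul, ← map_smul, ← Pi.single_smul, smul_eq_mul, mul_one]
    -- After clearing denominators, p is orthogonal to V only modulo P; the factor t makes it
    -- exactly orthogonal.
    have htp : t • p = 0 := by
      refine hV _ fun w hw => ?_
      rw [dotProduct_smul, smul_eq_mul]
      refine ht _ ((hι _).mp ?_)
      have h0 : φ (ι ∘ w) = 0 := hle (Submodule.subset_span ⟨w, hw, rfl⟩)
      rw [hφ'] at h0
      simp only [dotProduct, map_sum, map_mul, hpι]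
      rw [← mul_zero (algebraMap (R ⧸ P) K d), ← h0, Finset.mul_sum]
      exact Finset.sum_congr rfl fun j _ => by simp only [Function.comp_apply]; ring
    refine hφ (LinearMap.ext fun w => ?_)
    rw [hφ', LinearMap.zero_apply]
    refine Finset.sum_eq_zero fun j _ => ?_
    have hjP : p j ∈ P := by
      have h1 : t * p j = 0 := congrFun htp j
      exact (hprime.mem_or_mem (h1 ▸ P.zero_mem : t * p j ∈ P)).resolve_left htP
    have h2 := hpι j
    rw [(hι _).mpr hjP] at h2
    rw [(mul_eq_zero.mp h2.symm).resolve_left hd0, mul_zero]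

/-! ### The coordinate algebra of the trivial group -/

/-- A reduced algebra of finite type over an algebraically closed field with only one point is the
field itself. -/
theorem eq_algebraMap_of_subsingleton {k H : Type*} [Field k] [IsAlgClosed k] [CommRing H]
    [Algebra k H] [Algebra.FiniteType k H] [IsReduced H] [Subsingleton (H →ₐ[k] k)]
    (ε : H →ₐ[k] k) (h : H) : h = algebraMap k H (ε h) := by
  have : IsJacobsonRing H := isJacobsonRing_of_finiteType (A := k)
  -- By the Nullstellensatz each residue field is k, so each quotient map is a point and must equal
  -- ε. The Jacobson radical is the nilradical here.
  have key : h - algebraMap k H (ε h) ∈ (⊥ : Ideal H).jacobson := by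
    rw [Ideal.jacobson]
    refine Submodule.mem_sInf.mpr fun (m : Ideal H) hm => ?_
    have hmax : m.IsMaximal := hm.2
    let := Ideal.Quotient.field m
    have : Algebra.FiniteType k (H ⧸ m) :=
      Algebra.FiniteType.of_surjective (Ideal.Quotient.mkₐ k m) Ideal.Quotient.mk_surjective
    have : Module.Finite k (H ⧸ m) := finite_of_finite_type_of_isJacobsonRing k (H ⧸ m)
    let e : k ≃ₐ[k] H ⧸ m := AlgEquiv.ofBijective (Algebra.ofId k (H ⧸ m))
      IsAlgClosed.algebraMap_bijective_of_isIntegral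
    have he : ε = e.symm.toAlgHom.comp (Ideal.Quotient.mkₐ k m) := Subsingleton.elim _ _
    have h1 : e (ε h) = Ideal.Quotient.mk m h := by
      rw [he]; simp
    have h2 : e (ε h) = Ideal.Quotient.mk m (algebraMap k H (ε h)) := rfl
    rw [← Ideal.Quotient.eq_zero_iff_mem, map_sub, ← h1, ← h2, sub_self]
  rw [← Ideal.radical_eq_jacobson] at key
  exact sub_eq_zero.mp (eq_zero_of_mem_radical_bot key)

/-! ### Schur's lemma and density -/

section
variable {k H : Type*} [Field k] [IsAlgClosed k] [CommRing H] [Algebra k H] {n : ℕ}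

/-- A matrix over a `k`-algebra with a `k`-point becomes singular after the subtraction of a
scalar. -/
theorem exists_sub_algebraMap_not_bijective [NeZero n] (ε : H →ₐ[k] k)
    (f : Module.End H (Fin n → H)) :
    ∃ c : k, ¬ Function.Bijective (f - algebraMap k (Module.End H (Fin n → H)) c) := by
  let m := (LinearMap.toMatrix' f).map ε
  obtain ⟨c, hc⟩ := Module.End.exists_eigenvalue (Matrix.toLin' m)
  refine ⟨c, fun hb => ?_⟩
  have h1 : IsUnit (LinearMap.det (f - algebraMap k (Module.End H (Fin n → H)) c)) :=
    LinearEquiv.isUnit_det' (LinearEquiv.ofBijective _ hb)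
  obtain ⟨v, hv⟩ := hc.exists_hasEigenvector
  have h2 : ε (LinearMap.det (f - algebraMap k (Module.End H (Fin n → H)) c)) =
      (m - c • (1 : Matrix (Fin n) (Fin n) k)).det := by
    rw [← LinearMap.det_toMatrix', AlgHom.map_det]
    congr 1
    ext i j
    by_cases hij : i = j <;>
      simp [m, LinearMap.toMatrix'_apply, Algebra.algebraMap_eq_smul_one, hij]
  have h3 : (m - c • (1 : Matrix (Fin n) (Fin n) k)).det = 0 := by
    refine Matrix.exists_mulVec_eq_zero_iff.mp ⟨v, hv.2, ?_⟩
    have := hv.apply_eq_smul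
    rw [Matrix.toLin'_apply] at this
    rw [Matrix.sub_mulVec, this, Matrix.smul_mulVec, Matrix.one_mulVec, sub_self]
  exact (h1.map ε).ne_zero (h2.trans h3)

/-- A subalgebra of `End_k H^n` that contains `H` and acts irreducibly is dense. -/
theorem exists_mem_subalgebra_forall_eq [NeZero n] (ε : H →ₐ[k] k)
    (A : Subalgebra k (Module.End k (Fin n → H)))
    (hH : ∀ h : H, Algebra.lsmul k k (Fin n → H) h ∈ A)
    (hA : ∀ N : Submodule H (Fin n → H), (∀ α ∈ A, ∀ u ∈ N, α u ∈ N) → N = ⊥ ∨ N = ⊤)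
    (α : Module.End k (Fin n → H)) (s : Finset (Fin n → H)) :
    ∃ β ∈ A, ∀ u ∈ s, α u = β u := by
  have : Nontrivial H := ε.toRingHom.domain_nontrivial
  have hs : IsSimpleModule A (Fin n → H) := by
    -- Since A contains H, every A-submodule is an H-submodule.
    refine { eq_bot_or_eq_top := fun N => ?_ }
    let N' : Submodule H (Fin n → H) :=
      { N.toAddSubmonoid with smul_mem' := fun h u hu => N.smul_mem ⟨_, hH h⟩ hu }
    have hN : ∀ u, u ∈ N' ↔ u ∈ N := fun u => Iff.rfl
    rcases hA N' fun α hα u hu => N.smul_mem ⟨α, hα⟩ hu with h | h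
    · left; ext u; rw [← hN, h]; simp
    · right; ext u; rw [← hN, h]; simp
  have hscalar : ∀ φ : Module.End A (Fin n → H), ∃ c : k, ∀ u, φ u = c • u := by
    intro φ
    let f : Module.End H (Fin n → H) :=
      { φ with map_smul' := fun h u => φ.map_smul (⟨_, hH h⟩ : A) u }
    have hf : ∀ u, f u = φ u := fun u => rfl
    obtain ⟨c, hc⟩ := exists_sub_algebraMap_not_bijective ε f
    refine ⟨c, fun u => ?_⟩
    let ψ : Module.End A (Fin n → H) := φ - algebraMap k _ c
    have hψ : ⇑ψ = ⇑(f - algebraMap k (Module.End H (Fin n → H)) c) := by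
      ext u; simp [ψ, hf]
    rcases LinearMap.bijective_or_eq_zero (R := A) (M := Fin n → H) (N := Fin n → H) ψ with h | h
    · exact absurd (hψ ▸ h) hc
    · have := LinearMap.congr_fun h u
      simpa [ψ, sub_eq_zero] using this
  let F : Module.End (Module.End A (Fin n → H)) (Fin n → H) :=
    { α with
      map_smul' := fun φ u => by
        obtain ⟨c, hc⟩ := hscalar φ
        simp [hc] }
  obtain ⟨r, hr⟩ := jacobson_density (R := A) (M := Fin n → H) F s
  exact ⟨r, r.2, fun u hu => hr u hu⟩

end

/-! ### Points of G and left shifts -/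

open WithConv Coalgebra

variable {k H : Type*} [Field k] [CommRing H] [HopfAlgebra k H] {n : ℕ}

/-- A point of `G` as an `H`-valued point of the affine group scheme. -/
def constPt (g : Pt k H) : WithConv (H →ₐ[k] H) :=
  toConv ((Algebra.ofId k H).comp g.ofConv)

theorem constPt_mul (g g' : Pt k H) : constPt (g * g') = constPt g * constPt g' :=
  ofConv_injective (AlgHom.comp_convMul_distrib (Algebra.ofId k H) g g')

/-- The left shift as an algebra homomorphism. -/
def shift (g : Pt k H) : H →ₐ[k] H :=
  (constPt g * toConv (AlgHom.id k H)).ofConv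

theorem evalAt_tmul {M : Type*} [AddCommGroup M] [Module k M] (g : Pt k H) (h : H) (v : M) :
    evalAt g (h ⊗ₜ[k] v) = g h • v := by
  simp [evalAt]

theorem leftShift_eq_sum (g : Pt k H) {h : H} {ι : Type*} (r : Repr k h ι) :
    leftShift g h = ∑ i ∈ r.index, g (r.left i) • r.right i := by
  simp [leftShift, ← r.eq, evalAt_tmul]

theorem convMul_apply_eq_sum {A : Type*} [CommRing A] [Algebra k A]
    (f g : WithConv (H →ₐ[k] A)) {h : H} {ι : Type*} (r : Repr k h ι) :
    (f * g) h = ∑ i ∈ r.index, f (r.left i) * g (r.right i) := by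
  simp [AlgHom.convMul_apply, ← r.eq]

theorem shift_apply (g : Pt k H) (h : H) : shift g h = leftShift g h := by
  rw [leftShift_eq_sum g (ℛ k h)]
  refine (convMul_apply_eq_sum _ _ (ℛ k h)).trans ?_
  simp [constPt, Algebra.ofId_apply, Algebra.smul_def]

theorem leftShift_mul (g : Pt k H) (a b : H) :
    leftShift g (a * b) = leftShift g a * leftShift g b := by
  simp only [← shift_apply, map_mul]

theorem leftShift_leftShift (g g' : Pt k H) (h : H) :
    leftShift g (leftShift g' h) = leftShift (g' * g) h := by
  simp only [← shift_apply, ← AlgHom.comp_apply]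
  congr 1
  have h1 : (shift g).comp (constPt g').ofConv = (constPt g').ofConv := by
    ext x
    simp [constPt, Algebra.ofId_apply]
  rw [shift.eq_1 g', AlgHom.comp_convMul_distrib, shift.eq_1 (g' * g), constPt_mul, mul_assoc, h1]
  rfl

theorem leftShift_one (h : H) : leftShift (1 : Pt k H) h = h := by
  rw [leftShift_eq_sum _ (ℛ k h)]
  simpa using sum_counit_smul (ℛ k h)

/-- `h(z) = h₍₁₎(z x) S(h₍₂₎)(x)`. -/
theorem algebraMap_eq_sum (z : Pt k H) {h : H} {ι : Type*} (r : Repr k h ι) :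
    algebraMap k H (z h) =
      ∑ i ∈ r.index, leftShift z (r.left i) * HopfAlgebra.antipode k (r.right i) := by
  -- The shift is the constant point times the generic point, so the constant point is recovered in
  -- the group of H-valued points.
  have h1 : constPt z = toConv (shift z) * (toConv (AlgHom.id k H))⁻¹ := by
    rw [shift, toConv_ofConv, mul_inv_cancel_right]
  have h2 := congrArg (fun f : WithConv (H →ₐ[k] H) => f h) h1
  simp only [convMul_apply_eq_sum _ _ r] at h2
  simp only [shift_apply] at h2
  exact h2

theorem inv_antipode (g : Pt k H) (h : H) : g⁻¹ (HopfAlgebra.antipode k h) = g h :=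
  congrArg (fun f : Pt k H => f h) (inv_inv g)

/-! ### Conformal endomorphisms as kernels -/

/-- The map `z ↦ u (v(z x) · p(z x))` determined by a column `u` and a row `v`. -/
def kernel : (Fin n → H) →ₗ[k] (Fin n → H) →ₗ[k] EndMap k H n :=
  LinearMap.mk₂ k
    (fun u v z =>
      { toFun := fun p => leftShift z (v ⬝ᵥ p) • u
        map_add' := fun p q => by simp [dotProduct_add, add_smul]
        map_smul' := fun c p => by simp [dotProduct_smul] })
    (fun u u' v => by ext; simp)
    (fun c u v => by ext; simp)
    (fun u v v' => by ext; simp [add_dotProduct, add_mul])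
    (fun c u v => by ext; simp [smul_dotProduct])

@[simp]
theorem kernel_apply (u v : Fin n → H) (z : Pt k H) (p : Fin n → H) :
    kernel u v z p = leftShift z (v ⬝ᵥ p) • u := rfl

variable (k H n) in
/-- The parametrization of `Cend_n` by `M_n ⊗ M_n`, with respect to which the operators on `M_n`
act on the first factor. -/
def kernelMap : (Fin n → H) ⊗[k] (Fin n → H) →ₗ[k] EndMap k H n :=
  TensorProduct.lift kernel

@[simp]
theorem kernelMap_tmul (u v : Fin n → H) : kernelMap k H n (u ⊗ₜ v) = kernel u v := by
  simp [kernelMap]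

theorem cProd_add (g : Pt k H) (a b b' : EndMap k H n) :
    cProd g a (b + b') = cProd g a b + cProd g a b' := by
  ext; simp [cProd]

/-- Translation invariance moves a(g) past the coefficient: L_g L_{zg⁻¹} = L_z, so only the first
factor changes. -/
theorem cProd_kernelMap (g : Pt k H) {a : EndMap k H n} (ha : a ∈ Cend k H n)
    (t : (Fin n → H) ⊗[k] (Fin n → H)) :
    cProd g a (kernelMap k H n t) = kernelMap k H n ((a g).rTensor _ t) := by
  induction t with
  | zero => ext; simp [cProd]
  | add x y hx hy => simp [cProd_add, hx, hy]
  | tmul u v =>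
    funext z
    refine LinearMap.ext fun p => ?_
    simp [cProd, ha.2 g, leftShift_leftShift]

theorem lsmul_kernelMap (m : Module.End H (Fin n → H)) (t : (Fin n → H) ⊗[k] (Fin n → H)) :
    kernelMap k H n ((m.restrictScalars k).rTensor _ t) =
      fun z => m.restrictScalars k * kernelMap k H n t z := by
  induction t with
  | zero => ext; simp
  | add x y hx hy => ext; simp [hx, hy]
  | tmul u v =>
    funext z
    refine LinearMap.ext fun p => ?_
    simp

theorem lsmul_mem_cend (h : H) {a : EndMap k H n} (ha : a ∈ Cend k H n) :
    (fun g => Algebra.lsmul k k (Fin n → H) h * a g) ∈ Cend k H n := by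
  refine ⟨fun u => ?_, fun g f u => ?_⟩
  · obtain ⟨t, ht⟩ := ha.1 u
    refine ⟨(Algebra.lsmul k k (Fin n → H) h).lTensor _ t, fun g => ?_⟩
    have key : ∀ t : H ⊗[k] (Fin n → H),
        evalAt g ((Algebra.lsmul k k (Fin n → H) h).lTensor _ t) = h • evalAt g t := by
      intro t
      induction t with
      | zero => simp
      | add x y hx hy => simp [hx, hy]
      | tmul x y => simpa [evalAt_tmul] using smul_comm _ _ _
    simp [ht, key]
  · simpa [ha.2 g f u] using smul_comm _ _ _

/-- Every conformal endomorphism is given by a kernel. -/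
theorem exists_kernelMap_eq {a : EndMap k H n} (ha : a ∈ Cend k H n) :
    ∃ t, kernelMap k H n t = a := by
  have key : ∀ (j : Fin n) (t : H ⊗[k] (Fin n → H)), ∃ s, ∀ (z : Pt k H) (p : Fin n → H),
      kernelMap k H n s z p = leftShift z (p j) • evalAt z t := by
    intro j t
    induction t with
    | zero => exact ⟨0, fun z p => by simp⟩
    | add x y hx hy =>
      obtain ⟨s, hs⟩ := hx
      obtain ⟨s', hs'⟩ := hy
      exact ⟨s + s', fun z p => by simp [hs, hs']⟩
    | tmul h u =>
      -- The scalar h(z) is expanded by `algebraMap_eq_sum`; its shifted factor joins p j inside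
      -- L_z, and the antipode factor multiplies u.
      refine ⟨∑ i ∈ (ℛ k h).index, (HopfAlgebra.antipode k ((ℛ k h).right i) • u) ⊗ₜ
        (Pi.single j ((ℛ k h).left i)), fun z p => ?_⟩
      rw [evalAt_tmul, ← algebraMap_smul H (z h) u, algebraMap_eq_sum z (ℛ k h)]
      simp only [map_sum, kernelMap_tmul, Finset.sum_apply, LinearMap.sum_apply, kernel_apply,
        single_dotProduct, leftShift_mul, Finset.sum_smul, Finset.smul_sum, smul_smul]
      refine Finset.sum_congr rfl fun i _ => ?_
      congr 1
      ring
  choose t ht using fun j => ha.1 (Pi.single j 1)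
  choose s hs using fun j => key j (t j)
  refine ⟨∑ j, s j, funext fun z => LinearMap.ext fun p => ?_⟩
  have hp : p = ∑ j, p j • (Pi.single j (1 : H) : Fin n → H) := by
    ext i; simp [Finset.sum_apply, Pi.single_apply]
  conv_rhs => rw [hp]
  simp [hs, ← ht, ha.2 z]

/-! ### Closure properties and density for C_1 -/

theorem hAct_add (f : H) (a b : EndMap k H n) : hAct f (a + b) = hAct f a + hAct f b := by
  funext z; simp [hAct]

theorem hAct_smul (f : H) (c : k) (a : EndMap k H n) : hAct f (c • a) = c • hAct f a := by
  funext z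
  exact smul_comm (z⁻¹ f) c (a z)

theorem cProd_smul (g : Pt k H) (a : EndMap k H n) (c : k) (b : EndMap k H n) :
    cProd g a (c • b) = c • cProd g a b := by
  funext z; simp [cProd]

theorem adjoinH_le_cend {C : Submodule k (EndMap k H n)} (hC : C ≤ Cend k H n) :
    adjoinH C ≤ Cend k H n := by
  refine Submodule.span_le.mpr ?_
  rintro _ ⟨h, c, hc, rfl⟩
  exact lsmul_mem_cend h (hC hc)

theorem le_adjoinH (C : Submodule k (EndMap k H n)) : C ≤ adjoinH C := fun c hc =>
  Submodule.subset_span ⟨1, c, hc, by funext z; simp⟩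

theorem hAct_mem_adjoinH {C : Submodule k (EndMap k H n)} (hC : ∀ f : H, ∀ a ∈ C, hAct f a ∈ C)
    (f : H) {b : EndMap k H n} (hb : b ∈ adjoinH C) : hAct f b ∈ adjoinH C := by
  induction hb using Submodule.span_induction with
  | mem b hb =>
    obtain ⟨h, c, hc, rfl⟩ := hb
    exact Submodule.subset_span ⟨h, hAct f c, hC f c hc, by funext z; simp [hAct]⟩
  | zero => convert (adjoinH C).zero_mem; funext z; simp [hAct]
  | add x y _ _ hx hy => rw [hAct_add]; exact add_mem hx hy
  | smul c x _ hx => rw [hAct_smul]; exact Submodule.smul_mem _ _ hx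

theorem lsmul_mem_adjoinH {C : Submodule k (EndMap k H n)} (f : H) {b : EndMap k H n}
    (hb : b ∈ adjoinH C) :
    (fun z => Algebra.lsmul k k (Fin n → H) f * b z) ∈ adjoinH C := by
  induction hb using Submodule.span_induction with
  | mem b hb =>
    obtain ⟨h, c, hc, rfl⟩ := hb
    exact Submodule.subset_span ⟨f * h, c, hc, by funext z; simp [mul_assoc]⟩
  | zero => convert (adjoinH C).zero_mem; simp
  | add x y _ _ hx hy => convert add_mem hx hy; simp [mul_add]
  | smul c x _ hx => convert Submodule.smul_mem _ c hx; simp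

theorem cProd_mem_adjoinH {C : Submodule k (EndMap k H n)} (hC : IsConformalSubalgebra C)
    (g : Pt k H) {a b : EndMap k H n} (ha : a ∈ C) (hb : b ∈ adjoinH C) :
    cProd g a b ∈ adjoinH C := by
  induction hb using Submodule.span_induction with
  | mem b hb =>
    obtain ⟨h, c, hc, rfl⟩ := hb
    refine Submodule.subset_span ⟨leftShift g h, cProd g a c, hC.cProd_mem g a ha c hc, ?_⟩
    funext z
    refine LinearMap.ext fun p => ?_
    simp [cProd, (hC.le_cend ha).2 g]
  | zero => convert (adjoinH C).zero_mem; funext z; simp [cProd]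
  | add x y _ _ hx hy => rw [cProd_add]; exact add_mem hx hy
  | smul c x _ hx => rw [cProd_smul]; exact Submodule.smul_mem _ _ hx

/-- The operators on `M_n` whose action on kernels preserves a subspace of `Cend_n`. -/
def stabilizer (B : Submodule k (EndMap k H n)) : Subalgebra k (Module.End k (Fin n → H)) where
  carrier := {α | ∀ t, kernelMap k H n t ∈ B → kernelMap k H n (α.rTensor _ t) ∈ B}
  mul_mem' := fun {α β} hα hβ t ht => by
    rw [LinearMap.rTensor_mul]
    exact hα _ (hβ t ht)
  add_mem' := fun {α β} hα hβ t ht => by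
    rw [LinearMap.rTensor_add, LinearMap.add_apply, map_add]
    exact add_mem (hα t ht) (hβ t ht)
  algebraMap_mem' := fun c t ht => by
    rw [Algebra.algebraMap_eq_smul_one, LinearMap.rTensor_smul, LinearMap.smul_apply, map_smul,
      Module.End.one_eq_id, LinearMap.rTensor_id_apply]
    exact B.smul_mem c ht

theorem mem_stabilizer {B : Submodule k (EndMap k H n)} {α : Module.End k (Fin n → H)} :
    α ∈ stabilizer B ↔
      ∀ t, kernelMap k H n t ∈ B → kernelMap k H n (α.rTensor _ t) ∈ B := Iff.rfl

/-- By the density theorem, `C_1` is stable under all operators on `M_n`. -/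
theorem stabilizer_adjoinH_eq_top [IsAlgClosed k] [NeZero n] {C : Submodule k (EndMap k H n)}
    (hC : IsConformalSubalgebra C) (hirr : IsIrreducible C) : stabilizer (adjoinH C) = ⊤ := by
  have hH : ∀ h : H, Algebra.lsmul k k (Fin n → H) h ∈ stabilizer (adjoinH C) := by
    intro h
    refine mem_stabilizer.mpr fun t ht => ?_
    have := lsmul_kernelMap (k := k) (Module.toModuleEnd H (S := H) (Fin n → H) h) t
    exact this ▸ lsmul_mem_adjoinH h ht
  have hops : ∀ α ∈ operators C, α ∈ stabilizer (adjoinH C) := by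
    refine Submodule.span_le (p := (stabilizer (adjoinH C)).toSubmodule).mpr ?_
    rintro _ ⟨a, ha, g, rfl⟩
    refine mem_stabilizer.mpr fun t ht => ?_
    rw [← cProd_kernelMap g (hC.le_cend ha)]
    exact cProd_mem_adjoinH hC g ha ht
  refine eq_top_iff.mpr fun α _ => mem_stabilizer.mpr fun t ht => ?_
  obtain ⟨s, hs⟩ := TensorProduct.exists_finset t
  classical
  obtain ⟨β, hβ, hαβ⟩ := exists_mem_subalgebra_forall_eq (Bialgebra.counitAlgHom k H)
    (stabilizer (adjoinH C)) hH (fun N hN => hirr N fun α hα => hN α (hops α hα)) α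
    (s.image Prod.fst)
  have : α.rTensor _ t = β.rTensor (Fin n → H) t := by
    rw [hs, map_sum, map_sum]
    refine Finset.sum_congr rfl fun i hi => ?_
    rw [LinearMap.rTensor_tmul, LinearMap.rTensor_tmul, hαβ _ (Finset.mem_image_of_mem _ hi)]
  rw [this]
  exact mem_stabilizer.mp hβ t ht

theorem isLeftIdeal_of_stabilizer_eq_top {B : Submodule k (EndMap k H n)} (hB : B ≤ Cend k H n)
    (hact : ∀ f : H, ∀ b ∈ B, hAct f b ∈ B) (hst : stabilizer B = ⊤) : IsLeftIdeal B := by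
  refine ⟨hB, hact, fun g a ha b hb => ?_⟩
  obtain ⟨t, rfl⟩ := exists_kernelMap_eq (hB hb)
  rw [cProd_kernelMap g ha]
  exact mem_stabilizer.mp (hst ▸ Algebra.mem_top) t hb

/-! ### The module of rows -/

/-- L_z h = h₍₁₎(z) h₍₂₎, and h₍₁₎(z) = (S h₍₁₎)(z⁻¹) is a coefficient of the H-action. This is why
`rowModule` is closed under H. -/
theorem kernel_smul_right (h : H) (u v : Fin n → H) :
    (kernel u (h • v) : EndMap k H n) = ∑ i ∈ (ℛ k h).index,
      hAct (HopfAlgebra.antipode k ((ℛ k h).left i)) (kernel ((ℛ k h).right i • u) v) := by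
  funext z
  refine LinearMap.ext fun p => ?_
  simp only [kernel_apply, Finset.sum_apply, LinearMap.sum_apply, hAct, inv_antipode,
    LinearMap.smul_apply, smul_dotProduct, smul_eq_mul, leftShift_mul,
    leftShift_eq_sum z (ℛ k h), Finset.sum_mul, Finset.sum_smul]
  refine Finset.sum_congr rfl fun i _ => ?_
  rw [smul_mul_assoc, smul_assoc, smul_smul, mul_comm]

/-- The rows `v` such that `M_n ⊗ v` lies in `B`. -/
def rowModule (B : Submodule k (EndMap k H n)) (hact : ∀ f : H, ∀ b ∈ B, hAct f b ∈ B) :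
    Submodule H (Fin n → H) where
  carrier := {v | ∀ u, kernel u v ∈ B}
  add_mem' := fun {v w} hv hw u => by
    rw [map_add]
    exact add_mem (hv u) (hw u)
  zero_mem' := fun u => by
    rw [map_zero]
    exact B.zero_mem
  smul_mem' := fun h v hv u => by
    rw [kernel_smul_right]
    exact sum_mem fun i _ => hact _ _ (hv _)

section

variable {B : Submodule k (EndMap k H n)} {hact : ∀ f : H, ∀ b ∈ B, hAct f b ∈ B}

theorem mem_rowModule {v : Fin n → H} : v ∈ rowModule B hact ↔ ∀ u, kernel u v ∈ B := Iff.rfl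

/-- A subspace stable under all operators on `M_n` is `M_n ⊗ V` for the module of rows `V`. -/
theorem mem_span_kernel_rowModule (hB : B ≤ Cend k H n) (hst : stabilizer B = ⊤)
    {b : EndMap k H n} (hb : b ∈ B) :
    b ∈ Submodule.span k {x | ∃ u : Fin n → H, ∃ v ∈ rowModule B hact, x = kernel u v} := by
  classical
  obtain ⟨t, rfl⟩ := exists_kernelMap_eq (hB hb)
  let e := Module.Basis.ofVectorSpace k (Fin n → H)
  obtain ⟨c, rfl⟩ := TensorProduct.eq_repr_basis_left e t
  rw [Finsupp.sum, map_sum]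
  refine sum_mem fun i _ => Submodule.subset_span ⟨e i, c i, fun u => ?_, kernelMap_tmul _ _⟩
  -- The operator e_i ↦ u, e_j ↦ 0 for j ≠ i isolates the coefficient c i.
  have h1 : e.constr k (Pi.single i u) ∈ stabilizer B := hst ▸ Algebra.mem_top
  have h2 := mem_stabilizer.mp h1 _ hb
  have h3 : (c.sum fun j m => (e.constr k (Pi.single i u) (e j)) ⊗ₜ[k] m) = u ⊗ₜ[k] c i := by
    rw [Finsupp.sum, Finset.sum_eq_single i]
    · simp
    · intro j _ hj
      simp [hj]
    · intro hi
      simp [Finsupp.notMem_support_iff.mp hi]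
  rw [Finsupp.sum, map_sum] at h2
  simp only [LinearMap.rTensor_tmul] at h2
  rw [Finsupp.sum] at h3
  rwa [h3, kernelMap_tmul] at h2

end

/-! ### Row ideals and the transformation F -/

/-- The left ideal of the matrices with rows in a given submodule. -/
def rowIdeal {R : Type*} [CommRing R] (V : Submodule R (Fin n → R)) :
    Ideal (Matrix (Fin n) (Fin n) R) where
  carrier := {a | ∀ i, a i ∈ V}
  add_mem' := fun ha hb i => V.add_mem (ha i) (hb i)
  zero_mem' := fun _ => V.zero_mem
  smul_mem' := fun m a ha i => by
    have : (m • a) i = ∑ j, m i j • a j := by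
      ext l
      simp [Matrix.mul_apply]
    rw [this]
    exact sum_mem fun j _ => V.smul_mem _ (ha j)

theorem isEssential_rowIdeal {R : Type*} [CommRing R] {V : Submodule R (Fin n → R)}
    (hV : ∀ v : Fin n → R, v ≠ 0 → ∃ r : R, r • v ∈ V ∧ r • v ≠ 0) : IsEssential (rowIdeal V) := by
  intro I hI
  obtain ⟨m, hm, hm0⟩ := Submodule.exists_mem_ne_zero_of_ne_bot hI
  obtain ⟨i, hi⟩ := Function.ne_iff.mp hm0
  obtain ⟨r, hr, hr0⟩ := hV (m i) hi
  have hrow : (Matrix.single i i r * m) i = r • m i := by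
    ext l
    simp
  refine (Submodule.ne_bot_iff _).mpr ⟨Matrix.single i i r * m, ⟨fun j => ?_, I.mul_mem_left _ hm⟩,
    fun h0 => hr0 ?_⟩
  · by_cases hj : j = i
    · subst hj
      rwa [hrow]
    · have : (Matrix.single i i r * m) j = 0 := by
        ext l
        simp [Matrix.single_mul_apply_of_ne _ _ _ _ _ hj]
      rw [this]
      exact V.zero_mem
  · rw [← hrow, h0]
    rfl

theorem evalAt_fourier (z : Pt k H) (h x : H) :
    evalAt z⁻¹ (fourier (k := k) (h ⊗ₜ x)) = z⁻¹ h • leftShift z x := by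
  rw [leftShift_eq_sum z (ℛ k x)]
  have : fourier (k := k) (h ⊗ₜ x) = ∑ i ∈ (ℛ k x).index,
      (h * HopfAlgebra.antipode k ((ℛ k x).left i)) ⊗ₜ[k] ((ℛ k x).right i) := by
    simp [fourier, ← (ℛ k x).eq, Finset.mul_sum]
  simp [this, evalAt_tmul, inv_antipode, Finset.smul_sum, smul_smul]

/-- F turns a coefficient x into L_z x, and L_z(x) L_z(p) = L_z(xp), so each row of the matrix
becomes the second argument of a kernel. -/
theorem ofTensor_fourier (h : H) (a : Matrix (Fin n) (Fin n) H) :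
    ofTensor ((fourier (k := k) (H := H)).toLinearMap.mapMatrix (a.map fun x => h ⊗ₜ[k] x)) =
      hAct h (∑ i, kernel (Pi.single i 1) (a.row i)) := by
  funext z
  refine LinearMap.ext fun p => funext fun i => ?_
  simp [ofTensor, operatorAt, evalAt_fourier, hAct, Finset.sum_apply, Pi.single_apply,
    dotProduct, Finset.smul_sum, leftShift_mul]

theorem eq_sum_smul_leftShift (z : Pt k H) (h : H) :
    h = ∑ i ∈ (ℛ k h).index, z⁻¹ ((ℛ k h).left i) • leftShift z ((ℛ k h).right i) := by
  have := leftShift_leftShift z z⁻¹ h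
  rw [inv_mul_cancel, leftShift_one, leftShift_eq_sum z⁻¹ (ℛ k h)] at this
  simpa using this.symm

/-- Inverse of the transformation F: writing u_i = h₍₁₎(z⁻¹) L_z h₍₂₎ for h = u_i absorbs h₍₂₎ into
the row v and leaves h₍₁₎ as the H-coefficient. -/
theorem kernel_eq_sum_ofTensor (u v : Fin n → H) :
    (kernel u v : EndMap k H n) = ∑ i, ∑ j ∈ (ℛ k (u i)).index,
      ofTensor ((fourier (k := k) (H := H)).toLinearMap.mapMatrix
        ((Matrix.of (Pi.single i ((ℛ k (u i)).right j • v))).map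
          fun x => (ℛ k (u i)).left j ⊗ₜ[k] x)) := by
  funext z
  refine LinearMap.ext fun p => funext fun i => ?_
  simp only [ofTensor_fourier, Finset.sum_apply, LinearMap.sum_apply, hAct, LinearMap.smul_apply,
    kernel_apply, Matrix.of_row, Pi.smul_apply, smul_eq_mul, Pi.single_apply, mul_ite, mul_one,
    mul_zero]
  simp only [Finset.sum_ite_eq, Finset.mem_univ, if_true]
  rw [Finset.sum_eq_single i]
  · simp only [if_true, smul_dotProduct, smul_eq_mul, leftShift_mul]
    conv_lhs => rw [eq_sum_smul_leftShift z (u i)]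
    rw [Finset.mul_sum]
    refine Finset.sum_congr rfl fun j _ => ?_
    rw [mul_smul_comm, mul_comm]
  · intro j _ hj
    simp [hj.symm]
  · simp

theorem eq_fourierIdeal_rowIdeal {B : Submodule k (EndMap k H n)} (hB : B ≤ Cend k H n)
    (hact : ∀ f : H, ∀ b ∈ B, hAct f b ∈ B) (hst : stabilizer B = ⊤) :
    B = fourierIdeal (rowIdeal (rowModule B hact)) := by
  apply le_antisymm
  · intro b hb
    refine Submodule.span_le.mpr ?_ (mem_span_kernel_rowModule (hact := hact) hB hst hb)
    rintro _ ⟨u, v, hv, rfl⟩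
    rw [SetLike.mem_coe, kernel_eq_sum_ofTensor]
    refine sum_mem fun i _ => sum_mem fun j _ => Submodule.mem_map_of_mem
      (Submodule.mem_map_of_mem (Submodule.subset_span ⟨_, _, fun l => ?_, rfl⟩))
    by_cases hl : l = i
    · subst hl
      change (Pi.single l _ : Fin n → Fin n → H) l ∈ _
      rw [Pi.single_eq_same]
      exact Submodule.smul_mem _ _ hv
    · change (Pi.single i _ : Fin n → Fin n → H) l ∈ _
      rw [Pi.single_eq_of_ne hl]
      exact Submodule.zero_mem _
  · rw [fourierIdeal, tensorIdeal, Submodule.map_span, Submodule.map_span, Submodule.span_le]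
    rintro _ ⟨_, ⟨_, ⟨h, b, hb, rfl⟩, rfl⟩, rfl⟩
    rw [SetLike.mem_coe, ofTensor_fourier]
    exact hact _ _ (sum_mem fun i _ => hb i _)

/-! ### Essentiality and the case of the trivial group -/

/-- A nonzero irreducible conformal subalgebra kills no nonzero vector. -/
theorem eq_zero_of_forall_apply_eq_zero {C : Submodule k (EndMap k H n)} (hC : C ≤ Cend k H n)
    (hne : C ≠ ⊥) (hirr : IsIrreducible C) {p : Fin n → H}
    (hp : ∀ c ∈ C, ∀ z, c z p = 0) : p = 0 := by
  let N : Submodule H (Fin n → H) :=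
    { carrier := {q | ∀ c ∈ C, ∀ z, c z q = 0}
      add_mem' := fun hq hq' c hc z => by rw [map_add, hq c hc, hq' c hc, add_zero]
      zero_mem' := fun c _ z => map_zero _
      smul_mem' := fun h q hq c hc z => by rw [(hC hc).2, hq c hc, smul_zero] }
  have hN : ∀ α ∈ operators C, ∀ u ∈ N, α u = 0 := by
    intro α hα u hu
    induction hα using Submodule.span_induction with
    | mem α h =>
      obtain ⟨a, ha, g, rfl⟩ := h
      exact hu a ha g
    | zero => rfl
    | add x y _ _ hx hy => rw [LinearMap.add_apply, hx, hy, add_zero]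
    | smul c x _ hx => rw [LinearMap.smul_apply, hx, smul_zero]
  rcases hirr N fun α hα u hu => hN α hα u hu ▸ N.zero_mem with h | h
  · exact (Submodule.mem_bot H).mp (h ▸ (hp : p ∈ N))
  · refine absurd ((Submodule.eq_bot_iff _).mpr fun c hc => ?_) hne
    funext z
    refine LinearMap.ext fun q => ?_
    have hq : q ∈ N := h ▸ Submodule.mem_top
    exact hq c hc z

/-- A vector orthogonal to all rows is killed by the kernels spanning B, hence by C, so it vanishes.
-/
theorem exists_smul_mem_rowModule [Algebra.FiniteType k H] [IsReduced H]
    {C : Submodule k (EndMap k H n)} (hC : C ≤ Cend k H n) (hne : C ≠ ⊥) (hirr : IsIrreducible C)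
    {B : Submodule k (EndMap k H n)} (hCB : C ≤ B) (hB : B ≤ Cend k H n)
    (hact : ∀ f : H, ∀ b ∈ B, hAct f b ∈ B) (hst : stabilizer B = ⊤)
    (v : Fin n → H) (hv : v ≠ 0) :
    ∃ r : H, r • v ∈ rowModule B hact ∧ r • v ≠ 0 := by
  have : IsNoetherianRing H := Algebra.FiniteType.isNoetherianRing k H
  refine exists_smul_mem_of_orthogonal_eq_zero _ (fun p hp => ?_) hv
  refine eq_zero_of_forall_apply_eq_zero hC hne hirr fun c hc z => ?_
  have hspan := mem_span_kernel_rowModule (hact := hact) hB hst (hCB hc)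
  clear hc
  induction hspan using Submodule.span_induction with
  | mem x h =>
    obtain ⟨u, w, hw, rfl⟩ := h
    rw [kernel_apply, hp w hw, map_zero, zero_smul]
  | zero => rfl
  | add x y _ _ hx hy => rw [Pi.add_apply, LinearMap.add_apply, hx, hy, add_zero]
  | smul a x _ hx => rw [Pi.smul_apply, LinearMap.smul_apply, hx, smul_zero]

theorem adjoinH_eq_self {C : Submodule k (EndMap k H n)}
    (hH : ∀ h : H, ∃ c : k, h = algebraMap k H c) : adjoinH C = C := by
  refine le_antisymm (Submodule.span_le.mpr ?_) (le_adjoinH C)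
  rintro _ ⟨h, c, hc, rfl⟩
  obtain ⟨a, rfl⟩ := hH h
  have : (fun z => Algebra.lsmul k k (Fin n → H) (algebraMap k H a) * c z) = a • c := by
    funext z
    refine LinearMap.ext fun p => ?_
    simp
  exact this ▸ C.smul_mem a hc

theorem cend_le_of_rowModule_eq_top {B : Submodule k (EndMap k H n)}
    {hact : ∀ f : H, ∀ b ∈ B, hAct f b ∈ B} (hrow : rowModule B hact = ⊤) : Cend k H n ≤ B := by
  intro a ha
  obtain ⟨t, rfl⟩ := exists_kernelMap_eq ha
  clear ha
  induction t with
  | zero => rw [map_zero]; exact B.zero_mem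
  | add x y hx hy => rw [map_add]; exact add_mem hx hy
  | tmul u v =>
    rw [kernelMap_tmul]
    exact mem_rowModule.mp (hrow ▸ Submodule.mem_top : v ∈ rowModule B hact) u

end GConf

end

/-- Let `k` be an algebraically closed field, `G` a linear algebraic group over `k` with coordinate
Hopf algebra `H`, and `C` a nonzero irreducible conformal subalgebra of `Cend_n`. Then
`C_1 = (1 ⊗ H ⊗ E) C` is a left ideal of `Cend_n`, and `C_1 = F(H ⊗ B₀)` for an essential left ideal
`B₀` of `M_n(H)`. If `G = {e}`, then `C` is the whole of `Cend_n` (Burnside's theorem). -/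
theorem mainTheorem1 {k H : Type*} [Field k] [IsAlgClosed k] [CommRing H] [HopfAlgebra k H]
    [Algebra.FiniteType k H] [IsReduced H] (n : ℕ)
    (C : Submodule k (GConf.EndMap k H n)) (hC : GConf.IsConformalSubalgebra C)
    (hne : C ≠ ⊥) (hirr : GConf.IsIrreducible C) :
    GConf.IsLeftIdeal (GConf.adjoinH C) ∧
      (∃ B₀ : Ideal (Matrix (Fin n) (Fin n) H),
        GConf.IsEssential B₀ ∧ GConf.adjoinH C = GConf.fourierIdeal B₀) ∧
      (Subsingleton (GConf.Pt k H) → C = GConf.Cend k H n) := by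
  -- For n = 0 every map is zero, against C ≠ 0; the eigenvalue in Schur's lemma needs n > 0.
  have : NeZero n := ⟨by
    rintro rfl
    exact hne ((Submodule.eq_bot_iff _).mpr fun c _ => Subsingleton.elim _ _)⟩
  have hle := GConf.adjoinH_le_cend hC.le_cend
  have hact : ∀ f : H, ∀ b ∈ GConf.adjoinH C, GConf.hAct f b ∈ GConf.adjoinH C :=
    fun f b hb => GConf.hAct_mem_adjoinH hC.hAct_mem f hb
  have hst := GConf.stabilizer_adjoinH_eq_top hC hirr
  have hess := GConf.exists_smul_mem_rowModule hC.le_cend hne hirr (GConf.le_adjoinH C) hle hact hst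
  refine ⟨GConf.isLeftIdeal_of_stabilizer_eq_top hle hact hst,
    ⟨GConf.rowIdeal (GConf.rowModule _ hact), GConf.isEssential_rowIdeal hess,
      GConf.eq_fourierIdeal_rowIdeal hle hact hst⟩, fun hG => ?_⟩
  have hsub : Subsingleton (H →ₐ[k] k) := (WithConv.equiv (H →ₐ[k] k)).symm.subsingleton
  have hscalar : ∀ h : H, ∃ c : k, h = algebraMap k H c := fun h =>
    ⟨_, GConf.eq_algebraMap_of_subsingleton (Bialgebra.counitAlgHom k H) h⟩
  refine le_antisymm hC.le_cend ?_
  -- With H = k, the nonzero multiple of v supplied by essentiality can be divided by its scalar.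
  have hrow : GConf.rowModule _ hact = ⊤ := by
    refine eq_top_iff.mpr fun v _ => ?_
    by_cases hv : v = 0
    · exact hv ▸ Submodule.zero_mem _
    · obtain ⟨r, hr, hr0⟩ := hess v hv
      obtain ⟨c, rfl⟩ := hscalar r
      have hc : c ≠ 0 := by
        rintro rfl
        simp at hr0
      have := (GConf.rowModule _ hact).smul_mem (algebraMap k H c⁻¹) hr
      rwa [smul_smul, ← map_mul, inv_mul_cancel₀ hc, map_one, one_smul] at this
  exact (GConf.cend_le_of_rowModule_eq_top hrow).trans (GConf.adjoinH_eq_self hscalar).le
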